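/- All graphs are finite and simple. Let $G$ be a graph. For a vertex $v$, $G\setminus v$ is the graph obtained by deleting $v$, and $G*v$ (local complementation at $v$) is the graph on $V(G)$ obtained from $G$ by replacing the subgraph induced on the neighbours of $v$ with its complement. For an edge $uv$ of $G$, let $G\wedge uv=G*u*v*u$. For $X\subseteq V(G)$, the cut-rank $\rho_G(X)$ is the rank over $\mathrm{GF}(2)$ of the $X\times(V(G)\setminus X)$ submatrix of the adjacency matrix of $G$; for disjoint $S,T\subseteq V(G)$ let $$\kappa_G(S,T)=\min_{S\subseteq X\subseteq V(G)\setminus T}\rho_G(X).$$ **Theorem.** Let $G$ be a graph and let $Q,R,S,T\subseteq V(G)$ satisfy $Q\cap R=S\cap T=\emptyset$. Let $k=\kappa_G(Q,R)$, $\ell=\kappa_G(S,T)$ and $F=V(G)\setminus(Q\cup R\cup S\cup T)$. If $|F|\ge(2\ell+1)2^{2k}$, then there is a vertex $v\in F$ such that at least two of the following three conditions hold: 1. $\kappa_{G\setminus v}(Q,R)=k$ and $\kappa_{G\setminus v}(S,T)=\ell$; 2. $\kappa_{G*v\setminus v}(Q,R)=k$ and $\kappa_{G*v\setminus v}(S,T)=\ell$;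 3. for every neighbour $u$ of $v$ in $G$, $\kappa_{G\wedge uv\setminus v}(Q,R)=k$ and $\kappa_{G\wedge uv\setminus v}(S,T)=\ell$. -/

import Mathlib

/-! Local complementation, pivoting, vertex deletion, cut-rank and connectivity of finite simple
graphs. -/

namespace VertexMinor

variable {V : Type*}

/-- The local complementation `G * v`: adjacency is toggled between every two distinct
neighbours `x`, `y` of `v`, and all other adjacencies are kept. -/
def localComplement (G : SimpleGraph V) (v : V) : SimpleGraph V where
  Adj x y := x ≠ y ∧ Xor (G.Adj x y) (G.Adj v x ∧ G.Adj v y)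
  symm := ⟨fun x y h => by
    have hs : G.Adj x y ↔ G.Adj y x := G.adj_comm x y
    simp only [xor_def] at h ⊢
    tauto⟩
  loopless := ⟨fun _ h => h.1 rfl⟩

/-- The graph `G ∧ uv = G * u * v * u`; it is used only when `uv` is an edge of `G`. -/
def pivot (G : SimpleGraph V) (u v : V) : SimpleGraph V :=
  localComplement (localComplement (localComplement G u) v) u

/-- The graph `G \ v`, on the vertex set `V(G) - {v}`. -/
def deleteVertex (G : SimpleGraph V) (v : V) : SimpleGraph ({v}ᶜ : Set V) :=
  G.induce {v}ᶜ

open Classical in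
/-- The cut-rank `ρ_G(X)`: the rank over `GF(2)` of the submatrix of the adjacency matrix with
rows indexed by `X` and columns indexed by `V(G) - X`. -/
noncomputable def cutRank [Finite V] (G : SimpleGraph V) (X : Set V) : ℕ :=
  letI : Fintype V := Fintype.ofFinite V
  ((G.adjMatrix (ZMod 2)).submatrix
    (fun i : ↥X => (i : V)) (fun j : ↥(Xᶜ) => (j : V))).rank

/-- The connectivity `κ_G(S, T)`: the minimum of `ρ_G(X)` over `S ⊆ X ⊆ V(G) - T`. It is used only
for disjoint `S`, `T`, for which `X = S` is admissible, so that the infimum is a minimum. -/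
noncomputable def connectivity [Finite V] (G : SimpleGraph V) (S T : Set V) : ℕ :=
  sInf {r : ℕ | ∃ X : Set V, S ⊆ X ∧ X ⊆ Tᶜ ∧ cutRank G X = r}

/-- `κ_{H \ v}(Q, R) = k` and `κ_{H \ v}(S, T) = l`. It is used only for `v` outside
`Q ∪ R ∪ S ∪ T`, so that these sets are viewed as subsets of `V(H) - {v}`. -/
def DeletionHasConnectivities [Finite V] (H : SimpleGraph V) (v : V) (Q R S T : Set V)
    (k l : ℕ) : Prop :=
  connectivity (deleteVertex H v) (Subtype.val ⁻¹' Q) (Subtype.val ⁻¹' R) = k ∧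
  connectivity (deleteVertex H v) (Subtype.val ⁻¹' S) (Subtype.val ⁻¹' T) = l

/-- At least two of three propositions hold. -/
def AtLeastTwo (A B C : Prop) : Prop :=
  (A ∧ B) ∨ (A ∧ C) ∨ (B ∧ C)

end VertexMinor

namespace VertexMinor

theorem transpose_submatrix_adjMatrix {V α β : Type*} (G : SimpleGraph V) [DecidableRel G.Adj]
    (f : α → V) (g : β → V) :
    ((G.adjMatrix (ZMod 2)).submatrix f g).transpose = (G.adjMatrix (ZMod 2)).submatrix g f := by
  ext i j
  simp [SimpleGraph.adjMatrix_apply, G.adj_comm]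

/-! ### Cut-rank as the codimension of a space of supported vectors -/

section Supported

open Classical Module Matrix

variable {V : Type*} [Fintype V]

/-- The linear map given by the adjacency matrix over `GF(2)`. -/
noncomputable def neighborSum (G : SimpleGraph V) : (V → ZMod 2) →ₗ[ZMod 2] (V → ZMod 2) :=
  (G.adjMatrix (ZMod 2)).mulVecLin

/-- The vectors of the isotropic system of `G` that are supported on `X`. -/
noncomputable def supportedSpace (G : SimpleGraph V) (X : Set V) :
    Submodule (ZMod 2) (V → ZMod 2) where
  carrier := {p | ∀ v, v ∉ X → p v = 0 ∧ neighborSum G p v = 0}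
  zero_mem' := by simp
  add_mem' := by
    intro p q hp hq v hv
    simp [hp v hv, hq v hv]
  smul_mem' := by
    intro c p hp v hv
    simp [hp v hv]

theorem mem_supportedSpace {G : SimpleGraph V} {X : Set V} {p : V → ZMod 2} :
    p ∈ supportedSpace G X ↔ ∀ v, v ∉ X → p v = 0 ∧ neighborSum G p v = 0 := Iff.rfl

theorem neighborSum_apply (G : SimpleGraph V) (p : V → ZMod 2) (v : V) :
    neighborSum G p v = ∑ w, (if G.Adj v w then 1 else 0) * p w := by
  simp [neighborSum, Matrix.mulVec, dotProduct, SimpleGraph.adjMatrix_apply]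

theorem sum_neighborSum_comm (G : SimpleGraph V) (p q : V → ZMod 2) :
    ∑ v, p v * neighborSum G q v = ∑ v, neighborSum G p v * q v := by
  simp only [neighborSum_apply, Finset.mul_sum, Finset.sum_mul]
  rw [Finset.sum_comm]
  refine Finset.sum_congr rfl fun v _ => Finset.sum_congr rfl fun w _ => ?_
  simp only [G.adj_comm v w]
  ring

theorem supportedSpace_mono (G : SimpleGraph V) {X Y : Set V} (h : X ⊆ Y) :
    supportedSpace G X ≤ supportedSpace G Y :=
  fun _ hp v hv => hp v fun hx => hv (h hx)

theorem supportedSpace_inter (G : SimpleGraph V) (X Y : Set V) :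
    supportedSpace G (X ∩ Y) = supportedSpace G X ⊓ supportedSpace G Y := by
  refine le_antisymm (le_inf (supportedSpace_mono G Set.inter_subset_left)
    (supportedSpace_mono G Set.inter_subset_right)) ?_
  rintro p ⟨h1, h2⟩ v hv
  by_cases hx : v ∈ X
  · exact h2 v fun hy => hv ⟨hx, hy⟩
  · exact h1 v hx

/-- Restriction to a subset as an equivalence onto the kernel of a submatrix. -/
noncomputable def supportedSpaceEquiv (G : SimpleGraph V) (X : Set V) :
    supportedSpace G X ≃ₗ[ZMod 2]
      LinearMap.ker ((G.adjMatrix (ZMod 2)).submatrix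
        (fun i : ↥(Xᶜ) => (i : V)) (fun j : ↥X => (j : V))).mulVecLin where
  toFun p := ⟨fun i => p.1 i, by
    rw [LinearMap.mem_ker]
    funext w
    have h := (p.2 w w.2).2
    rw [neighborSum_apply] at h
    simp only [Matrix.mulVecLin_apply, Matrix.mulVec, dotProduct, Matrix.submatrix_apply,
      SimpleGraph.adjMatrix_apply, Pi.zero_apply]
    refine Eq.trans ?_ h
    rw [← Finset.sum_subset (Finset.subset_univ (Finset.univ.filter (· ∈ X)))]
    · exact (Finset.sum_subtype _ (fun x => by simp)
        (fun x => (if G.Adj w x then 1 else 0) * p.1 x)).symm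
    · intro x _ hx
      rw [(p.2 x (by simpa using hx)).1, mul_zero]⟩
  map_add' p q := rfl
  map_smul' c p := rfl
  invFun q := ⟨fun v => if h : v ∈ X then q.1 ⟨v, h⟩ else 0, by
    intro w hw
    refine ⟨by simp [hw], ?_⟩
    have h := congrFun (LinearMap.mem_ker.1 q.2) ⟨w, hw⟩
    simp only [Matrix.mulVecLin_apply, Matrix.mulVec, dotProduct, Matrix.submatrix_apply,
      SimpleGraph.adjMatrix_apply, Pi.zero_apply] at h
    rw [neighborSum_apply]
    refine Eq.trans ?_ h
    rw [← Finset.sum_subset (Finset.subset_univ (Finset.univ.filter (· ∈ X)))]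
    · rw [Finset.sum_subtype (p := (· ∈ X)) _ (fun x => by simp)]
      exact Finset.sum_congr rfl fun x _ => by rw [dif_pos x.2]
    · intro x _ hx
      rw [dif_neg (by simpa using hx), mul_zero]⟩
  left_inv p := by
    ext v
    by_cases h : v ∈ X
    · simp [h]
    · simp [h, (p.2 v h).1]
  right_inv q := by
    ext v
    simp

theorem cutRank_eq_rank (G : SimpleGraph V) (X : Set V) [Fintype ↥(Xᶜ)] :
    cutRank G X = ((G.adjMatrix (ZMod 2)).submatrix
      (fun i : ↥X => (i : V)) (fun j : ↥(Xᶜ) => (j : V))).rank := by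
  unfold cutRank
  convert rfl

theorem cutRank_compl (G : SimpleGraph V) (X : Set V) : cutRank G Xᶜ = cutRank G X := by
  rw [cutRank_eq_rank, cutRank_eq_rank, ← Matrix.rank_transpose, transpose_submatrix_adjMatrix,
    ← Matrix.rank_submatrix _ (Equiv.setCongr (compl_compl X)) (Equiv.refl _)]
  rfl

/-- Rank–nullity for the Xᶜ × X block, whose kernel is the supported space. -/
theorem finrank_supportedSpace_add_cutRank (G : SimpleGraph V) (X : Set V) :
    finrank (ZMod 2) (supportedSpace G X) + cutRank G X = X.ncard := by
  have h := LinearMap.finrank_range_add_finrank_ker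
    ((G.adjMatrix (ZMod 2)).submatrix
        (fun i : ↥(Xᶜ) => (i : V)) (fun j : ↥X => (j : V))).mulVecLin
  rw [← (supportedSpaceEquiv G X).finrank_eq] at h
  rw [Module.finrank_fintype_fun_eq_card, ← Nat.card_eq_fintype_card,
    Nat.card_coe_set_eq] at h
  rw [← h, add_comm]
  rw [cutRank_eq_rank, ← Matrix.rank_transpose, transpose_submatrix_adjMatrix]
  rfl

/-- The space of X ∩ Y is the intersection of the two spaces, and the space of X ∪ Y contains their
sum. -/
theorem cutRank_submodular (G : SimpleGraph V) (X Y : Set V) :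
    cutRank G (X ∩ Y) + cutRank G (X ∪ Y) ≤ cutRank G X + cutRank G Y := by
  have h1 := finrank_supportedSpace_add_cutRank G X
  have h2 := finrank_supportedSpace_add_cutRank G Y
  have h3 := finrank_supportedSpace_add_cutRank G (X ∩ Y)
  have h4 := finrank_supportedSpace_add_cutRank G (X ∪ Y)
  have h5 := Set.ncard_union_add_ncard_inter X Y
  have h6 := Submodule.finrank_sup_add_finrank_inf_eq (supportedSpace G X) (supportedSpace G Y)
  rw [← supportedSpace_inter] at h6
  have h7 := Submodule.finrank_mono (sup_le
    (supportedSpace_mono G (Set.subset_union_left (s := X) (t := Y)))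
    (supportedSpace_mono G (Set.subset_union_right (s := X) (t := Y))))
  omega

theorem finrank_le_finrank_inf_ker_add_one {E : Type*} [AddCommGroup E] [Module (ZMod 2) E]
    [FiniteDimensional (ZMod 2) E] (S : Submodule (ZMod 2) E) (f : E →ₗ[ZMod 2] ZMod 2) :
    finrank (ZMod 2) S ≤
      finrank (ZMod 2) (S ⊓ LinearMap.ker f : Submodule (ZMod 2) E) + 1 := by
  have h1 := Submodule.finrank_sup_add_finrank_inf_eq S (LinearMap.ker f)
  have h2 := LinearMap.finrank_range_add_finrank_ker f
  have h3 := Submodule.finrank_le (S ⊔ LinearMap.ker f)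
  have h4 := Submodule.finrank_le (LinearMap.range f)
  rw [finrank_self] at h4
  omega

end Supported

theorem zmod_two_add_self (a : ZMod 2) : a + a = 0 := CharTwo.add_self_eq_zero a

theorem localComplement_adj_self {V : Type*} (G : SimpleGraph V) (v w : V) :
    (localComplement G v).Adj w v ↔ G.Adj w v := by
  have := G.ne_of_adj (a := w) (b := v)
  simp only [localComplement, SimpleGraph.irrefl, and_false, xor_def, not_false_eq_true,
    false_and, or_false, and_true]
  tauto

open Classical in
-- The rank-one term also changes the diagonal at neighbours of v; the last summand cancels this.
theorem localComplement_entry {V : Type*} (G : SimpleGraph V) (v w x : V) :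
    (if (localComplement G v).Adj w x then 1 else 0 : ZMod 2) =
      (if G.Adj w x then 1 else 0) + (if G.Adj v w then 1 else 0) * (if G.Adj v x then 1 else 0) +
      if w = x then (if G.Adj v w then 1 else 0) else 0 := by
  by_cases h : w = x
  · subst h
    by_cases h1 : G.Adj v w <;> simp [h1, zmod_two_add_self]
  · by_cases h1 : G.Adj v w <;> by_cases h2 : G.Adj v x <;> by_cases h3 : G.Adj w x <;>
      simp [localComplement, xor_def, h, h1, h2, h3, zmod_two_add_self]

/-! ### The three vertex removals as three functionals -/

section LocalEquivalence

open Classical Module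

variable {V : Type*} [Fintype V]

/-- The functional `p ↦ τ.1 * p v + τ.2 * (A p) v`. The three nonzero choices of `τ` correspond to
the three ways of removing the vertex `v`. -/
noncomputable def typeFunctional (G : SimpleGraph V) (τ : ZMod 2 × ZMod 2) (v : V) :
    (V → ZMod 2) →ₗ[ZMod 2] ZMod 2 :=
  τ.1 • LinearMap.proj v + τ.2 • (LinearMap.proj v ∘ₗ neighborSum G)

@[simp]
theorem typeFunctional_apply (G : SimpleGraph V) (τ : ZMod 2 × ZMod 2) (v : V)
    (p : V → ZMod 2) :
    typeFunctional G τ v p = τ.1 * p v + τ.2 * neighborSum G p v := by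
  simp [typeFunctional]

theorem neighborSum_single (G : SimpleGraph V) (v w : V) (s : ZMod 2) :
    neighborSum G (Pi.single v s) w = if G.Adj w v then s else 0 := by
  simp [neighborSum_apply, Pi.single_apply]

/-- The action of local complementation at `v` on the isotropic system. -/
noncomputable def localComplementEquiv (G : SimpleGraph V) (v : V) :
    (V → ZMod 2) ≃ₗ[ZMod 2] (V → ZMod 2) :=
  LinearEquiv.ofInvolutive
    (LinearMap.id + LinearMap.single (ZMod 2) (fun _ : V => ZMod 2) v ∘ₗ
      LinearMap.proj v ∘ₗ neighborSum G) (by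
    intro p
    ext w
    by_cases h : w = v
    · subst h
      simp [neighborSum_single, add_assoc, zmod_two_add_self]
    · simp [h])

theorem localComplementEquiv_apply (G : SimpleGraph V) (v : V) (p : V → ZMod 2) :
    localComplementEquiv G v p = p + Pi.single v (neighborSum G p v) := rfl

theorem neighborSum_localComplement (G : SimpleGraph V) (v : V) (p : V → ZMod 2) (w : V) :
    neighborSum (localComplement G v) (localComplementEquiv G v p) w =
      neighborSum G p w + if G.Adj v w then p w else 0 := by
  rw [localComplementEquiv_apply, map_add, Pi.add_apply, neighborSum_single,
    localComplement_adj_self]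
  have h : neighborSum (localComplement G v) p w = neighborSum G p w +
      (if G.Adj v w then neighborSum G p v else 0) + if G.Adj v w then p w else 0 := by
    simp only [neighborSum_apply, localComplement_entry, add_mul, Finset.sum_add_distrib]
    congr 1
    · congr 1
      by_cases h1 : G.Adj v w <;> simp [h1]
    · by_cases h1 : G.Adj v w <;> simp [h1]
  rw [h, G.adj_comm w v]
  by_cases h1 : G.Adj v w
  · simp only [h1, if_true]
    linear_combination zmod_two_add_self (neighborSum G p v)
  · simp [h1]

/-- At each vertex the map acts on the pair (p_w, (Ap)_w) by an invertible 2 × 2 matrix, so supports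
are unchanged. -/
theorem localComplementEquiv_mem (G : SimpleGraph V) (v : V) (X : Set V) (p : V → ZMod 2) :
    localComplementEquiv G v p ∈ supportedSpace (localComplement G v) X ↔
      p ∈ supportedSpace G X := by
  simp only [mem_supportedSpace]
  refine forall₂_congr fun w _ => ?_
  rw [neighborSum_localComplement, localComplementEquiv_apply]
  by_cases h : w = v
  · subst h
    simp only [Pi.add_apply, Pi.single_eq_same, SimpleGraph.irrefl, if_false, add_zero]
    constructor
    · rintro ⟨h1, h2⟩
      simpa [h2] using h1
    · rintro ⟨h1, h2⟩
      simp [h1, h2]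
  · simp only [Pi.add_apply, Pi.single_eq_of_ne h, add_zero]
    refine and_congr_right fun h1 => ?_
    simp [h1]

/-- `H` is locally equivalent to `G`, and the removal of `v` from `H` is the removal of `v` from `G`
in the way given by `τ`. -/
def IsTransferOfType (G H : SimpleGraph V) (v : V) (τ : ZMod 2 × ZMod 2) : Prop :=
  ∃ φ : (V → ZMod 2) ≃ₗ[ZMod 2] (V → ZMod 2),
    (∀ X p, φ p ∈ supportedSpace H X ↔ p ∈ supportedSpace G X) ∧
    ∀ p, φ p v = typeFunctional G τ v p

theorem isTransferOfType_refl (G : SimpleGraph V) (v : V) : IsTransferOfType G G v (1, 0) :=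
  ⟨LinearEquiv.refl _ _, fun _ _ => Iff.rfl, fun p => by simp⟩

theorem isTransferOfType_localComplement (G : SimpleGraph V) (v : V) :
    IsTransferOfType G (localComplement G v) v (1, 1) :=
  ⟨localComplementEquiv G v, localComplementEquiv_mem G v, fun p => by
    simp [localComplementEquiv_apply]⟩

theorem isTransferOfType_pivot {G : SimpleGraph V} {u v : V} (h : G.Adj u v) :
    IsTransferOfType G (pivot G u v) v (0, 1) := by
  refine ⟨localComplementEquiv G u ≪≫ₗ localComplementEquiv (localComplement G u) v ≪≫ₗ
    localComplementEquiv (localComplement (localComplement G u) v) u, fun X p => ?_, fun p => ?_⟩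
  · simp only [LinearEquiv.trans_apply, pivot, localComplementEquiv_mem]
  · simp only [LinearEquiv.trans_apply]
    rw [localComplementEquiv_apply (localComplement (localComplement G u) v) u]
    rw [localComplementEquiv_apply (localComplement G u) v]
    simp only [Pi.add_apply, Pi.single_eq_of_ne h.ne', Pi.single_eq_same, add_zero,
      neighborSum_localComplement, h, if_true]
    rw [localComplementEquiv_apply]
    simp only [Pi.add_apply, Pi.single_eq_of_ne h.ne', add_zero, typeFunctional_apply]
    -- Complementing at u adds p_v to (Ap)_v; complementing at v then turns p_v into p_v + (Ap)_v +
    -- p_v. The last complementation at u leaves this coordinate alone.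
    linear_combination zmod_two_add_self (p v)

/-- The vectors supported on `X` in the graph obtained by deleting `v`. -/
noncomputable def deleteVertexEquiv (G : SimpleGraph V) (v : V) (X : Set V) :
    supportedSpace (deleteVertex G v) (Subtype.val ⁻¹' X) ≃ₗ[ZMod 2]
      (supportedSpace G (insert v X) ⊓ LinearMap.ker (LinearMap.proj v) :
        Submodule (ZMod 2) (V → ZMod 2)) :=
  have key : ∀ (p : V → ZMod 2), p v = 0 → ∀ w : ({v}ᶜ : Set V),
      neighborSum (deleteVertex G v) (fun i => p i) w = neighborSum G p w := by
    intro p hp w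
    rw [neighborSum_apply, neighborSum_apply,
      ← Finset.sum_subset (Finset.subset_univ (Finset.univ.filter (· ∈ ({v}ᶜ : Set V))))]
    · exact (Finset.sum_subtype _ (fun x => by simp)
        (fun x => (if G.Adj w x then 1 else 0) * p x)).symm
    · intro x _ hx
      have : x = v := by simpa using hx
      rw [this, hp, mul_zero]
  have ext : ∀ (q : ({v}ᶜ : Set V) → ZMod 2),
      (fun i : ({v}ᶜ : Set V) => (fun w => if h : w ∈ ({v}ᶜ : Set V) then q ⟨w, h⟩ else 0) (i : V))
        = q := by
    intro q
    funext i
    exact dif_pos i.2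
  { toFun := fun q => ⟨fun w => if h : w ∈ ({v}ᶜ : Set V) then q.1 ⟨w, h⟩ else 0, by
      refine ⟨fun w hw => ?_, by simp⟩
      have hwv : w ∈ ({v}ᶜ : Set V) := fun h => hw (Set.mem_insert_iff.2 (Or.inl h))
      have hq := q.2 ⟨w, hwv⟩ fun h => hw (Set.mem_insert_of_mem v h)
      refine ⟨(dif_pos hwv).trans hq.1, ?_⟩
      rw [← key _ (by simp) ⟨w, hwv⟩, ext]
      exact hq.2⟩
    map_add' := fun p q => by
      ext w
      by_cases h : w = v <;> simp [h]
    map_smul' := fun c p => by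
      ext w
      by_cases h : w = v <;> simp [h]
    invFun := fun p => ⟨fun i => p.1 i, fun w hw => by
      have hw' : (w : V) ∉ insert v X := by
        rintro (h | h)
        exacts [w.2 h, hw h]
      rw [key _ p.2.2]
      exact p.2.1 w hw'⟩
    left_inv := fun q => Subtype.ext (ext q.1)
    right_inv := fun p => by
      refine Subtype.ext (funext fun w => ?_)
      by_cases h : w ∈ ({v}ᶜ : Set V)
      · exact dif_pos h
      · have hw : w = v := by simpa using h
        refine (dif_neg h).trans ?_
        rw [hw]
        exact p.2.2.symm }

/-- All three removals are thereby measured inside the single space of G. -/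
theorem finrank_supportedSpace_deleteVertex {G H : SimpleGraph V} {v : V} {τ : ZMod 2 × ZMod 2}
    (h : IsTransferOfType G H v τ) (X : Set V) :
    finrank (ZMod 2) (supportedSpace (deleteVertex H v) (Subtype.val ⁻¹' X)) =
      finrank (ZMod 2) (supportedSpace G (insert v X) ⊓ LinearMap.ker (typeFunctional G τ v) :
        Submodule (ZMod 2) (V → ZMod 2)) := by
  obtain ⟨φ, h1, h2⟩ := h
  rw [(deleteVertexEquiv H v X).finrank_eq]
  have e : (supportedSpace G (insert v X) ⊓ LinearMap.ker (typeFunctional G τ v) :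
        Submodule (ZMod 2) (V → ZMod 2)).map φ.toLinearMap =
      supportedSpace H (insert v X) ⊓ LinearMap.ker (LinearMap.proj v) := by
    ext q
    obtain ⟨p, rfl⟩ := φ.surjective q
    simp only [Submodule.mem_map, Submodule.mem_inf, LinearMap.mem_ker, LinearMap.proj_apply]
    constructor
    · rintro ⟨p', ⟨h3, h4⟩, h5⟩
      obtain rfl : p' = p := φ.injective h5
      exact ⟨(h1 _ _).2 h3, (h2 _).trans h4⟩
    · rintro ⟨h3, h4⟩
      exact ⟨p, ⟨(h1 _ _).1 h3, (h2 _).symm.trans h4⟩, rfl⟩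
  rw [← e]
  exact LinearEquiv.finrank_map_eq φ _

end LocalEquivalence

/-! ### Tight sets and reducing types -/

section Tight

open Classical Module

variable {V : Type*} [Fintype V]

theorem connectivity_le_cutRank {G : SimpleGraph V} {Q R X : Set V} (h1 : Q ⊆ X) (h2 : X ⊆ Rᶜ) :
    connectivity G Q R ≤ cutRank G X :=
  Nat.sInf_le ⟨X, h1, h2, rfl⟩

/-- A set attaining the connectivity between `Q` and `R`. -/
structure IsTight (G : SimpleGraph V) (Q R X : Set V) : Prop where
  left : Q ⊆ X
  right : X ⊆ Rᶜ
  cutRank_eq : cutRank G X = connectivity G Q R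

theorem exists_isTight (G : SimpleGraph V) {Q R : Set V} (h : Q ∩ R = ∅) :
    ∃ X, IsTight G Q R X := by
  have hne : {r : ℕ | ∃ X : Set V, Q ⊆ X ∧ X ⊆ Rᶜ ∧ cutRank G X = r}.Nonempty :=
    ⟨_, Q, subset_rfl, fun x hx hr => (h ▸ ⟨hx, hr⟩ : x ∈ (∅ : Set V)), rfl⟩
  obtain ⟨X, h1, h2, h3⟩ := Nat.sInf_mem hne
  exact ⟨X, h1, h2, h3⟩

namespace IsTight

variable {G : SimpleGraph V} {Q R X Y : Set V}

theorem inter (hX : IsTight G Q R X) (hY : IsTight G Q R Y) : IsTight G Q R (X ∩ Y) := by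
  have h1 : Q ⊆ X ∩ Y := Set.subset_inter hX.left hY.left
  have h2 : X ∩ Y ⊆ Rᶜ := Set.inter_subset_left.trans hX.right
  have h3 : X ∪ Y ⊆ Rᶜ := Set.union_subset hX.right hY.right
  have h4 := connectivity_le_cutRank (G := G) h1 h2
  have h5 := connectivity_le_cutRank (G := G) (hX.left.trans (Set.subset_union_left (t := Y))) h3
  have h6 := cutRank_submodular G X Y
  have h7 := hX.cutRank_eq
  have h8 := hY.cutRank_eq
  exact ⟨h1, h2, by omega⟩

theorem union (hX : IsTight G Q R X) (hY : IsTight G Q R Y) : IsTight G Q R (X ∪ Y) := by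
  have h1 : Q ⊆ X ∩ Y := Set.subset_inter hX.left hY.left
  have h2 : X ∩ Y ⊆ Rᶜ := Set.inter_subset_left.trans hX.right
  have h3 : X ∪ Y ⊆ Rᶜ := Set.union_subset hX.right hY.right
  have h0 := hX.left.trans (Set.subset_union_left (t := Y))
  have h4 := connectivity_le_cutRank (G := G) h1 h2
  have h5 := connectivity_le_cutRank (G := G) h0 h3
  have h6 := cutRank_submodular G X Y
  have h7 := hX.cutRank_eq
  have h8 := hY.cutRank_eq
  exact ⟨h0, h3, by omega⟩

theorem finrank_insert {v : V} (hv : v ∉ X) (hX : IsTight G Q R X)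
    (hX' : IsTight G Q R (insert v X)) :
    finrank (ZMod 2) (supportedSpace G (insert v X)) =
      finrank (ZMod 2) (supportedSpace G X) + 1 := by
  have h1 := finrank_supportedSpace_add_cutRank G X
  have h2 := finrank_supportedSpace_add_cutRank G (insert v X)
  rw [Set.ncard_insert_of_notMem hv] at h2
  have h7 := hX.cutRank_eq
  have h8 := hX'.cutRank_eq
  omega

theorem exists_mem_insert {v : V} (hv : v ∉ X) (hX : IsTight G Q R X)
    (hX' : IsTight G Q R (insert v X)) :
    ∃ w ∈ supportedSpace G (insert v X), ¬ (w v = 0 ∧ neighborSum G w v = 0) := by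
  by_contra! h
  have hle : supportedSpace G (insert v X) ≤ supportedSpace G X := by
    intro p hp u hu
    by_cases huv : u = v
    · subst huv
      exact ⟨(h p hp).1, (h p hp).2⟩
    · exact hp u (by simp [huv, hu])
  have h1 := Submodule.finrank_mono hle
  have h2 := finrank_insert hv hX hX'
  omega

end IsTight

/-- Some pair of tight sets differing in `v` shows that removing `v` from `G` in the way given
by `τ` decreases the connectivity between `Q` and `R`. -/
def IsReducing (G : SimpleGraph V) (Q R : Set V) (v : V) (τ : ZMod 2 × ZMod 2) : Prop :=
  ∃ X, v ∉ X ∧ IsTight G Q R X ∧ IsTight G Q R (insert v X) ∧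
    ∀ p ∈ supportedSpace G (insert v X), typeFunctional G τ v p = 0

theorem zmod_two_eq_zero_of_symplectic (α β a b c d : ZMod 2) (h : ¬ (a = 0 ∧ b = 0))
    (h1 : α * a + β * b = 0) (h2 : a * d + b * c = 0) : α * c + β * d = 0 := by
  revert α β a b c d
  decide

/-- Any functional independent of τ serves as σ. -/
theorem exists_complementary_type (τ : ZMod 2 × ZMod 2) (h : τ ≠ 0) :
    ∃ σ : ZMod 2 × ZMod 2, ∀ a b : ZMod 2, τ.1 * a + τ.2 * b = 0 → σ.1 * a + σ.2 * b = 0 →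
      a = 0 ∧ b = 0 := by
  revert τ
  decide

theorem finrank_supportedSpace_insert_le {G : SimpleGraph V} {τ : ZMod 2 × ZMod 2} (h0 : τ ≠ 0)
    {v : V} {X : Set V} (h : ∀ p ∈ supportedSpace G (insert v X), typeFunctional G τ v p = 0) :
    finrank (ZMod 2) (supportedSpace G (insert v X)) ≤
      finrank (ZMod 2) (supportedSpace G X) + 1 := by
  obtain ⟨σ, hσ⟩ := exists_complementary_type τ h0
  refine (finrank_le_finrank_inf_ker_add_one _ (typeFunctional G σ v)).trans
    (Nat.add_le_add_right (Submodule.finrank_mono ?_) 1)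
  rintro p ⟨hp, hp1⟩ u hu
  by_cases huv : u = v
  · subst huv
    have hp0 := h p hp
    have hp2 : typeFunctional G σ u p = 0 := hp1
    rw [typeFunctional_apply] at hp0 hp2
    exact hσ _ _ hp0 hp2
  · exact hp u (by simp [huv, hu])

theorem sum_symplectic (G : SimpleGraph V) (p q : V → ZMod 2) :
    ∑ v, (p v * neighborSum G q v + neighborSum G p v * q v) = 0 := by
  rw [Finset.sum_add_distrib, sum_neighborSum_comm, zmod_two_add_self]

theorem symplectic_eq_zero {G : SimpleGraph V} {p q : V → ZMod 2} {X Y : Set V} {v : V}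
    (hp : p ∈ supportedSpace G X) (hq : q ∈ supportedSpace G Y) (h : X ∩ Y ⊆ {v}) :
    p v * neighborSum G q v + neighborSum G p v * q v = 0 := by
  rw [← sum_symplectic G p q, eq_comm]
  refine Finset.sum_eq_single v (fun u _ huv => ?_) (by simp)
  by_cases hu : u ∈ X
  · have := hq u fun hy => huv (h ⟨hu, hy⟩)
    simp [this.1, this.2]
  · have := hp u hu
    simp [this.1, this.2]

namespace IsReducing

variable {G : SimpleGraph V} {Q R : Set V} {v : V} {τ : ZMod 2 × ZMod 2}

/-- Intersecting E with the tight set X that witnesses the reduction gives a tight pair again. The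
vector it gains at v is supported on both X + v and E + v, so τ kills it. -/
theorem exists_mem_of_isTight (h : IsReducing G Q R v τ) {E : Set V}
    (hE : IsTight G Q R E) (hE' : IsTight G Q R (insert v E)) :
    ∃ w ∈ supportedSpace G (insert v E), ¬ (w v = 0 ∧ neighborSum G w v = 0) ∧
      typeFunctional G τ v w = 0 := by
  obtain ⟨X, hvX, hX, hX', hτ⟩ := h
  have h1 := hX'.inter hE'
  rw [← Set.insert_inter_distrib] at h1
  obtain ⟨w, hw, hw0⟩ := IsTight.exists_mem_insert (fun h => hvX h.1) (hX.inter hE) h1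
  refine ⟨w, supportedSpace_mono G (Set.insert_subset_insert Set.inter_subset_right) hw, hw0,
    hτ w (supportedSpace_mono G (Set.insert_subset_insert Set.inter_subset_left) hw)⟩

/-- A vector on E + v and one on Eᶜ overlap at most at v, so their values there are symplectically
orthogonal. In a plane this makes the second a multiple of the first whenever the first is nonzero.
-/
theorem typeFunctional_eq_zero_of_compl (h : IsReducing G Q R v τ) {E : Set V}
    (hE : IsTight G Q R E) (hE' : IsTight G Q R (insert v E)) {p : V → ZMod 2}
    (hp : p ∈ supportedSpace G Eᶜ) : typeFunctional G τ v p = 0 := by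
  obtain ⟨w, hw, hw0, hw1⟩ := h.exists_mem_of_isTight hE hE'
  rw [typeFunctional_apply] at hw1 ⊢
  refine zmod_two_eq_zero_of_symplectic _ _ _ _ _ _ hw0 hw1 (symplectic_eq_zero hw hp ?_)
  rintro u ⟨h1 | h1, h2⟩
  · exact h1
  · exact absurd h1 h2

theorem typeFunctional_eq_zero (h : IsReducing G Q R v τ) {E : Set V} (hv : v ∉ E)
    (hE : IsTight G Q R E) (hE' : IsTight G Q R (insert v E)) {p : V → ZMod 2}
    (hp : p ∈ supportedSpace G (insert v E)) : typeFunctional G τ v p = 0 := by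
  obtain ⟨w, hw, hw0, hw1⟩ := h.exists_mem_of_isTight hE hE'
  have hlt : supportedSpace G E <
      supportedSpace G (insert v E) ⊓ LinearMap.ker (typeFunctional G τ v) := by
    refine lt_of_le_of_ne (le_inf (supportedSpace_mono G (Set.subset_insert v E)) ?_) ?_
    · intro q hq
      simp [(hq v hv).1, (hq v hv).2]
    · intro he
      have : w ∈ supportedSpace G E := he ▸ ⟨hw, hw1⟩
      exact hw0 (this v hv)
  have h1 := Submodule.finrank_lt_finrank_of_lt hlt
  have h2 := IsTight.finrank_insert hv hE hE'
  have h3 := Submodule.eq_of_le_of_finrank_le (S₁ := supportedSpace G (insert v E) ⊓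
    LinearMap.ker (typeFunctional G τ v)) inf_le_left (by omega)
  rw [← h3] at hp
  exact hp.2

theorem of_connectivity_ne {H : SimpleGraph V} (h0 : τ ≠ 0) (hQR : Q ∩ R = ∅)
    (hvQ : v ∉ Q) (hvR : v ∉ R) (hτ : IsTransferOfType G H v τ)
    (hne : connectivity (deleteVertex H v) (Subtype.val ⁻¹' Q) (Subtype.val ⁻¹' R) ≠
      connectivity G Q R) : IsReducing G Q R v τ := by
  have hdim : ∀ X : Set V, v ∉ X →
      finrank (ZMod 2) (supportedSpace G (insert v X) ⊓ LinearMap.ker (typeFunctional G τ v) :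
        Submodule (ZMod 2) (V → ZMod 2)) + cutRank (deleteVertex H v) (Subtype.val ⁻¹' X) =
      X.ncard := by
    intro X hX
    have h1 := finrank_supportedSpace_add_cutRank (deleteVertex H v) (Subtype.val ⁻¹' X)
    rw [Set.ncard_preimage_of_injective_subset_range Subtype.val_injective] at h1
    · rw [← h1, ← finrank_supportedSpace_deleteVertex hτ]
    · intro x hx
      exact ⟨⟨x, fun h => hX (Set.mem_singleton_iff.1 h ▸ hx)⟩, rfl⟩
  -- Removal never raises the connectivity: take a tight set of G and drop v from it.
  have hle : connectivity (deleteVertex H v) (Subtype.val ⁻¹' Q) (Subtype.val ⁻¹' R) ≤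
      connectivity G Q R := by
    obtain ⟨X, hX⟩ := exists_isTight G hQR
    have h1 : connectivity (deleteVertex H v) (Subtype.val ⁻¹' Q) (Subtype.val ⁻¹' R) ≤
        cutRank (deleteVertex H v) (Subtype.val ⁻¹' (X \ {v})) :=
      connectivity_le_cutRank (fun x hx => ⟨hX.left hx, x.2⟩) (fun x hx => hX.right hx.1)
    have h2 := hdim (X \ {v}) (by simp)
    rw [Set.insert_sdiff_singleton] at h2
    have h3 := finrank_supportedSpace_add_cutRank G X
    rw [← hX.cutRank_eq]
    by_cases hv : v ∈ X
    · rw [Set.insert_eq_of_mem hv] at h2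
      have h4 := finrank_le_finrank_inf_ker_add_one (supportedSpace G X) (typeFunctional G τ v)
      have h5 := Set.ncard_sdiff_singleton_add_one hv
      omega
    · rw [Set.sdiff_singleton_eq_self hv] at h1 h2
      have h4 : supportedSpace G X ≤
          supportedSpace G (insert v X) ⊓ LinearMap.ker (typeFunctional G τ v) := by
        refine le_inf (supportedSpace_mono G (Set.subset_insert v X)) fun q hq => ?_
        simp [(hq v hv).1, (hq v hv).2]
      have h5 := Submodule.finrank_mono h4
      omega
  have hlt := lt_of_le_of_ne hle hne
  have hdisj : (Subtype.val ⁻¹' Q : Set ({v}ᶜ : Set V)) ∩ Subtype.val ⁻¹' R = ∅ := by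
    rw [← Set.preimage_inter, hQR, Set.preimage_empty]
  obtain ⟨X', hX'⟩ := exists_isTight (deleteVertex H v) hdisj
  obtain ⟨X, hvX, rfl⟩ : ∃ X : Set V, v ∉ X ∧ X' = Subtype.val ⁻¹' X := by
    refine ⟨Subtype.val '' X', ?_, (Set.preimage_image_eq _ Subtype.val_injective).symm⟩
    rintro ⟨x, -, hx⟩
    exact x.2 hx
  have hQX : Q ⊆ X := fun x hx =>
    hX'.left (a := ⟨x, fun h => hvQ (Set.mem_singleton_iff.1 h ▸ hx)⟩) hx
  have hXR : X ⊆ Rᶜ := fun x hx =>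
    hX'.right (a := ⟨x, fun h => hvX (Set.mem_singleton_iff.1 h ▸ hx)⟩) hx
  have hXR' : insert v X ⊆ Rᶜ := Set.insert_subset hvR hXR
  have h1 := hdim X hvX
  have h2 := finrank_supportedSpace_add_cutRank G X
  have h3 := finrank_supportedSpace_add_cutRank G (insert v X)
  rw [Set.ncard_insert_of_notMem hvX] at h3
  have h4 := connectivity_le_cutRank (G := G) hQX hXR
  have h5 := connectivity_le_cutRank (G := G) (hQX.trans (Set.subset_insert v X)) hXR'
  have h6 := hX'.cutRank_eq
  -- X has cut-rank below κ after removal, while X + v has cut-rank at least κ in G; hence the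
  -- functional costs no dimension.
  have h7 : (supportedSpace G (insert v X) ⊓ LinearMap.ker (typeFunctional G τ v) :
      Submodule (ZMod 2) (V → ZMod 2)) = supportedSpace G (insert v X) :=
    Submodule.eq_of_le_of_finrank_le inf_le_left (by omega)
  have h8 : finrank (ZMod 2) (supportedSpace G (insert v X)) ≤
      finrank (ZMod 2) (supportedSpace G X) + 1 := by
    refine finrank_supportedSpace_insert_le h0 fun p hp => ?_
    rw [← h7] at hp
    exact hp.2
  rw [h7] at h1
  refine ⟨X, hvX, ⟨hQX, hXR, by omega⟩, ⟨hQX.trans (Set.subset_insert v X), hXR', by omega⟩, ?_⟩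
  intro p hp
  rw [← h7] at hp
  exact hp.2

end IsReducing

end Tight

/-! ### Ordering F by a chain of tight sets -/

section Chain

open Classical Module

variable {V : Type*} [Fintype V] {G : SimpleGraph V} {Q R F : Set V}

theorem exists_isTight_disjoint (hQR : Q ∩ R = ∅)
    (hF : ∀ v ∈ F, ∃ τ, IsReducing G Q R v τ) : ∃ A, IsTight G Q R A ∧ F ∩ A = ∅ := by
  obtain ⟨A, hA, hmin⟩ := exists_minimalFor_of_wellFoundedLT (IsTight G Q R) Set.ncard
    (exists_isTight G hQR)
  refine ⟨A, hA, Set.eq_empty_of_forall_notMem ?_⟩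
  rintro v ⟨hvF, hvA⟩
  obtain ⟨τ, X, hvX, hX, -⟩ := hF v hvF
  have h1 := hmin (hA.inter hX) (Set.ncard_le_ncard Set.inter_subset_left)
  have h2 : A ∩ X ⊂ A :=
    Set.ssubset_iff_subset_ne.2 ⟨Set.inter_subset_left, fun h => hvX (h.ge hvA).2⟩
  exact absurd (Set.ncard_lt_ncard h2) (not_lt.2 h1)

/-- Take D minimal among tight sets containing A and a new element u of F. If X, X + u is the tight
pair at u, then (X ∪ A) ∩ D with u added is D by minimality; without u it is smaller, so it gains no
element of F. -/
theorem exists_isTight_succ (hF : ∀ v ∈ F, ∃ τ, IsReducing G Q R v τ) {A : Set V}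
    (hA : IsTight G Q R A) (hFA : ¬ F ⊆ A) :
    ∃ u ∈ F, ∃ E, u ∉ E ∧ IsTight G Q R E ∧ IsTight G Q R (insert u E) ∧ A ⊆ E ∧
      F ∩ E = F ∩ A := by
  have hne : ∃ D, IsTight G Q R D ∧ A ⊆ D ∧ ¬ F ∩ D ⊆ A := by
    obtain ⟨v, hvF, hvA⟩ := Set.not_subset.1 hFA
    obtain ⟨τ, X, -, -, hX, -⟩ := hF v hvF
    exact ⟨A ∪ insert v X, hA.union hX, Set.subset_union_left,
      fun h => hvA (h ⟨hvF, Or.inr (Set.mem_insert v X)⟩)⟩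
  obtain ⟨D, ⟨hD, hAD, hFD⟩, hmin⟩ := exists_minimalFor_of_wellFoundedLT
    (fun D => IsTight G Q R D ∧ A ⊆ D ∧ ¬ F ∩ D ⊆ A) Set.ncard hne
  have hmin' : ∀ E, IsTight G Q R E → A ⊆ E → ¬ F ∩ E ⊆ A → E ⊆ D → E = D := by
    intro E h1 h2 h3 h4
    exact Set.eq_of_subset_of_ncard_le h4 (hmin ⟨h1, h2, h3⟩ (Set.ncard_le_ncard h4))
  obtain ⟨u, ⟨huF, huD⟩, huA⟩ := Set.not_subset.1 hFD
  obtain ⟨τ, X, huX, hX, hX', -⟩ := hF u huF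
  have h1 : IsTight G Q R ((X ∪ A) ∩ D) := (hX.union hA).inter hD
  have h2 : u ∉ (X ∪ A) ∩ D := by
    rintro ⟨h | h, -⟩
    exacts [huX h, huA h]
  have h3 : A ⊆ (X ∪ A) ∩ D := Set.subset_inter Set.subset_union_right hAD
  have h4 : insert u ((X ∪ A) ∩ D) = D := by
    have h5 : insert u ((X ∪ A) ∩ D) = (insert u X ∪ A) ∩ D := by
      rw [Set.insert_union, Set.insert_inter_of_mem huD]
    rw [h5]
    refine hmin' _ ((hX'.union hA).inter hD) (Set.subset_inter Set.subset_union_right hAD)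
      (fun h => huA (h ⟨huF, Or.inl (Set.mem_insert u X), huD⟩)) Set.inter_subset_right
  refine ⟨u, huF, _, h2, h1, h4.symm ▸ hD, h3, ?_⟩
  refine subset_antisymm (fun x hx => ⟨hx.1, ?_⟩) (Set.inter_subset_inter_right F h3)
  by_contra hxA
  have h6 := hmin' _ h1 h3 (fun h => hxA (h hx)) Set.inter_subset_right
  exact h2 (h6.symm ▸ huD)

/-- A chain of tight sets passing through the elements of `F` one at a time. -/
theorem exists_isTight_chain (hQR : Q ∩ R = ∅) (hF : ∀ v ∈ F, ∃ τ, IsReducing G Q R v τ) :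
    ∃ D : ℕ → Set V, Monotone D ∧ (∀ i, IsTight G Q R (D i)) ∧ F ∩ D 0 = ∅ ∧
      ∀ i < F.ncard, ∃ u ∈ F, ∃ E, u ∉ E ∧ IsTight G Q R E ∧ IsTight G Q R (insert u E) ∧
        F ∩ E = F ∩ D i ∧ F ∩ D (i + 1) = insert u (F ∩ D i) := by
  obtain ⟨A, hA, hFA⟩ := exists_isTight_disjoint hQR hF
  have hstep : ∀ A : {A // IsTight G Q R A}, ∃ B : {A // IsTight G Q R A}, A.1 ⊆ B.1 ∧
      (¬ F ⊆ A.1 → ∃ u ∈ F, ∃ E, u ∉ E ∧ IsTight G Q R E ∧ IsTight G Q R (insert u E) ∧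
        F ∩ E = F ∩ A.1 ∧ F ∩ B.1 = insert u (F ∩ A.1)) := by
    rintro ⟨A, hA⟩
    by_cases h : F ⊆ A
    · exact ⟨⟨A, hA⟩, subset_rfl, fun h' => absurd h h'⟩
    · obtain ⟨u, hu, E, h1, h2, h3, h4, h5⟩ := exists_isTight_succ hF hA h
      refine ⟨⟨insert u E, h3⟩, h4.trans (Set.subset_insert u E), fun _ =>
        ⟨u, hu, E, h1, h2, h3, h5, ?_⟩⟩
      rw [Set.inter_insert_of_mem hu, h5]
  choose next hsub hnext using hstep
  let D : ℕ → {A // IsTight G Q R A} := fun n => next^[n] ⟨A, hA⟩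
  have hD : ∀ n, D (n + 1) = next (D n) := fun n => Function.iterate_succ_apply' next n _
  -- This keeps F from being exhausted before step |F|; later terms need only be tight and
  -- increasing.
  have hcard : ∀ n, (F ∩ (D n).1).ncard ≤ n := by
    intro n
    induction n with
    | zero =>
      have : F ∩ (D 0).1 = ∅ := hFA
      rw [this, Set.ncard_empty]
    | succ n ih =>
      rw [hD]
      by_cases h : F ⊆ (D n).1
      · rw [Set.inter_eq_left.2 (h.trans (hsub _))]
        rw [Set.inter_eq_left.2 h] at ih
        omega
      · obtain ⟨u, -, E, -, -, -, -, h5⟩ := hnext _ h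
        rw [h5]
        exact (Set.ncard_insert_le _ _).trans (by omega)
  refine ⟨fun n => (D n).1, monotone_nat_of_le_succ fun n => ?_, fun n => (D n).2, hFA,
    fun i hi => ?_⟩
  · rw [hD]
    exact hsub _
  · simp only [hD]
    refine hnext _ fun h => ?_
    have := hcard i
    rw [Set.inter_eq_left.2 h] at this
    omega

/-- `pos` orders `F` so that in every subset of `F` the first and the last element `u`
admit only vectors of type `τ u` at `u`. -/
structure IsTypedOrder {α : Type*} [LinearOrder α] (G : SimpleGraph V) (F : Set V)
    (τ : V → ZMod 2 × ZMod 2) (pos : V → α) : Prop where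
  injOn : Set.InjOn pos F
  last : ∀ Z ⊆ F, ∀ u ∈ Z, (∀ z ∈ Z, pos z ≤ pos u) → ∀ p ∈ supportedSpace G Z,
    typeFunctional G (τ u) u p = 0
  first : ∀ Z ⊆ F, ∀ u ∈ Z, (∀ z ∈ Z, pos u ≤ pos z) → ∀ p ∈ supportedSpace G Z,
    typeFunctional G (τ u) u p = 0

theorem exists_chain_and_isTypedOrder (hQR : Q ∩ R = ∅) {τ : V → ZMod 2 × ZMod 2}
    (hF : ∀ v ∈ F, IsReducing G Q R v (τ v)) :
    ∃ (D : ℕ → Set V) (pos : V → ℕ), Monotone D ∧ (∀ i, IsTight G Q R (D i)) ∧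
      (∀ i ≤ F.ncard, (F ∩ D i).ncard = i) ∧ IsTypedOrder G F τ pos := by
  obtain ⟨D, hmono, htight, h0, hstep⟩ := exists_isTight_chain hQR fun v hv => ⟨_, hF v hv⟩
  have hcard : ∀ i ≤ F.ncard, (F ∩ D i).ncard = i := by
    intro i
    induction i with
    | zero => intro _; rw [h0, Set.ncard_empty]
    | succ i ih =>
      intro hi
      obtain ⟨u, hu, E, h1, h2, h3, h4, h5⟩ := hstep i hi
      rw [h5, Set.ncard_insert_of_notMem, ih (by omega)]
      rw [← h4]
      exact fun h => h1 h.2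
  have hall : F ⊆ D F.ncard := Set.inter_eq_left.1
    (Set.eq_of_subset_of_ncard_le Set.inter_subset_left (hcard _ le_rfl).ge)
  have hex : ∀ u ∈ F, ∃ i, u ∈ D i := fun u hu => ⟨_, hall hu⟩
  -- The index at which u enters the chain; 0 is a junk value for vertices that never enter.
  let pos : V → ℕ := fun u => if h : ∃ i, u ∈ D i then Nat.find h else 0
  have hpos : ∀ u ∈ F, ∀ i, pos u ≤ i ↔ u ∈ D i := by
    intro u hu i
    simp only [pos, dif_pos (hex u hu), Nat.find_le_iff]
    exact ⟨fun ⟨j, hj, h⟩ => hmono hj h, fun h => ⟨i, le_rfl, h⟩⟩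
  have hkey : ∀ u ∈ F, ∃ E, u ∉ E ∧ IsTight G Q R E ∧ IsTight G Q R (insert u E) ∧
      (∀ z ∈ F, pos z ≤ pos u → z ∈ insert u E) ∧ ∀ z ∈ F, pos u ≤ pos z → z ∉ E := by
    intro u hu
    have hu0 : pos u ≠ 0 := by
      intro h
      have : u ∈ F ∩ D 0 := ⟨hu, (hpos u hu 0).1 h.le⟩
      rw [h0] at this
      exact this
    obtain ⟨i, hi⟩ := Nat.exists_eq_succ_of_ne_zero hu0
    have him : pos u ≤ F.ncard := (hpos u hu _).2 (hall hu)
    obtain ⟨v, hv, E, h1, h2, h3, h4, h5⟩ := hstep i (by omega)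
    have hui : u ∉ D i := fun h => by
      have := (hpos u hu i).2 h
      omega
    obtain rfl : u = v := by
      have : u ∈ F ∩ D (i + 1) := ⟨hu, (hpos u hu _).1 (by omega)⟩
      rw [h5] at this
      rcases this with h | h
      exacts [h, absurd h.2 hui]
    refine ⟨E, h1, h2, h3, fun z hz hzu => ?_, fun z hz hzu hzE => ?_⟩
    · have : z ∈ F ∩ D (i + 1) := ⟨hz, (hpos z hz _).1 (by omega)⟩
      rw [h5, ← h4] at this
      rcases this with h | h
      exacts [Or.inl h, Or.inr h.2]
    · have : z ∈ F ∩ E := ⟨hz, hzE⟩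
      rw [h4] at this
      have := (hpos z hz i).2 this.2
      omega
  refine ⟨D, pos, hmono, htight, hcard, fun u hu v hv huv => ?_, fun Z hZ u hu hmax p hp => ?_,
    fun Z hZ u hu hmin p hp => ?_⟩
  · obtain ⟨E, h1, -, -, h4, h5⟩ := hkey u hu
    rcases h4 v hv huv.ge with h | h
    · exact h.symm
    · exact absurd h (h5 v hv huv.le)
  · obtain ⟨E, h1, h2, h3, h4, -⟩ := hkey u (hZ hu)
    exact (hF u (hZ hu)).typeFunctional_eq_zero h1 h2 h3
      (supportedSpace_mono G (fun z hz => h4 z (hZ hz) (hmax z hz)) hp)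
  · obtain ⟨E, h1, h2, h3, -, h5⟩ := hkey u (hZ hu)
    exact (hF u (hZ hu)).typeFunctional_eq_zero_of_compl h2 h3
      (supportedSpace_mono G (fun z hz => h5 z (hZ hz) (hmin z hz)) hp)

end Chain

/-! ### Two typed orders force logarithmic cut-rank -/

section Peeling

open Classical Module

variable {V : Type*} [Fintype V] {G : SimpleGraph V} {F : Set V} {α β : Type*} [LinearOrder α]
  [LinearOrder β]

theorem cutRank_le_cutRank_insert {τ : ZMod 2 × ZMod 2} (h0 : τ ≠ 0) {v : V} {X : Set V}
    (hv : v ∉ X) (h : ∀ p ∈ supportedSpace G (insert v X), typeFunctional G τ v p = 0) :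
    cutRank G X ≤ cutRank G (insert v X) := by
  have h1 := finrank_supportedSpace_insert_le h0 h
  have h2 := finrank_supportedSpace_add_cutRank G X
  have h3 := finrank_supportedSpace_add_cutRank G (insert v X)
  rw [Set.ncard_insert_of_notMem hv] at h3
  omega

theorem types_separate (σ τ : ZMod 2 × ZMod 2) (hσ : σ ≠ 0) (hτ : τ ≠ 0) (h : σ ≠ τ)
    (a b : ZMod 2) (h1 : σ.1 * a + σ.2 * b = 0) (h2 : τ.1 * a + τ.2 * b = 0) :
    a = 0 ∧ b = 0 := by
  revert σ τ a b
  decide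

/-- Two distinct types kill both coordinates at v, so adding v gains no vector. -/
theorem cutRank_insert_of_two_types {σ τ : ZMod 2 × ZMod 2} (hσ : σ ≠ 0) (hτ : τ ≠ 0)
    (hne : σ ≠ τ) {v : V} {X : Set V} (hv : v ∉ X)
    (h1 : ∀ p ∈ supportedSpace G (insert v X), typeFunctional G σ v p = 0)
    (h2 : ∀ p ∈ supportedSpace G (insert v X), typeFunctional G τ v p = 0) :
    cutRank G X + 1 ≤ cutRank G (insert v X) := by
  have hle : supportedSpace G (insert v X) ≤ supportedSpace G X := by
    intro p hp u hu
    by_cases huv : u = v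
    · subst huv
      have h3 := h1 p hp
      have h4 := h2 p hp
      rw [typeFunctional_apply] at h3 h4
      exact types_separate σ τ hσ hτ hne _ _ h3 h4
    · exact hp u (by simp [huv, hu])
  have h5 := Submodule.finrank_mono hle
  have h6 := finrank_supportedSpace_add_cutRank G X
  have h7 := finrank_supportedSpace_add_cutRank G (insert v X)
  rw [Set.ncard_insert_of_notMem hv] at h7
  omega

namespace IsTypedOrder

variable {τ σ : V → ZMod 2 × ZMod 2} {pos : V → α} {qos : V → β}

/-- Turns statements about lower parts into statements about upper parts. -/
theorem dual (h : IsTypedOrder G F τ pos) : IsTypedOrder G F τ (OrderDual.toDual ∘ pos) where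
  injOn := OrderDual.toDual.injective.comp_injOn h.injOn
  last := h.first
  first := h.last

/-- Remove the elements outside Y from the top; each is last in what remains, so its type bounds the
loss of dimension by one. -/
theorem cutRank_le_of_lower (h : IsTypedOrder G F τ pos) (hτ : ∀ v ∈ F, τ v ≠ 0)
    {Y Z : Set V} (hZ : Z ⊆ F) (hYZ : Y ⊆ Z)
    (hlow : ∀ z ∈ Z, ∀ y ∈ Y, pos z ≤ pos y → z ∈ Y) : cutRank G Y ≤ cutRank G Z := by
  induction hn : Z.ncard using Nat.strong_induction_on generalizing Z with
  | _ n ih =>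
    by_cases hZY : Z ⊆ Y
    · rw [subset_antisymm hYZ hZY]
    · have hne : Z.Nonempty := Set.nonempty_iff_ne_empty.2 fun h0 =>
        hZY (h0 ▸ Set.empty_subset Y)
      obtain ⟨u, hu, hmax⟩ := Set.exists_max_image Z pos (Set.toFinite Z) hne
      have huY : u ∉ Y := fun huY => hZY fun z hz => hlow z hz u huY (hmax z hz)
      have h1 : insert u (Z \ {u}) = Z := by
        rw [Set.insert_sdiff_singleton, Set.insert_eq_of_mem hu]
      have h2 : cutRank G (Z \ {u}) ≤ cutRank G (insert u (Z \ {u})) := by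
        refine cutRank_le_cutRank_insert (hτ u (hZ hu)) (by simp) ?_
        rw [h1]
        exact h.last Z hZ u hu hmax
      rw [h1] at h2
      refine le_trans (ih (Z \ {u}).ncard ?_ (Set.sdiff_subset.trans hZ) ?_ ?_ rfl) h2
      · rw [← hn]
        exact Set.ncard_sdiff_singleton_lt_of_mem hu
      · exact fun y hy => ⟨hYZ hy, fun hyu => huY (Set.mem_singleton_iff.1 hyu ▸ hy)⟩
      · exact fun z hz y hy => hlow z hz.1 y hy

/-- In the part of Z up to u in the second order, u is last for both orders. Removing it therefore
lowers the cut-rank strictly. -/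
theorem cutRank_lower_succ_le (h : IsTypedOrder G F τ pos) (h' : IsTypedOrder G F σ qos)
    (hτ : ∀ v ∈ F, τ v ≠ 0) (hσ : ∀ v ∈ F, σ v ≠ 0) (hne : ∀ v ∈ F, τ v ≠ σ v)
    {Z : Set V} (hZ : Z ⊆ F) {u : V} (hu : u ∈ Z) (hmax : ∀ z ∈ Z, pos z ≤ pos u) :
    cutRank G {z ∈ Z | qos z < qos u} + 1 ≤ cutRank G Z := by
  have hsub : insert u {z ∈ Z | qos z < qos u} ⊆ Z :=
    Set.insert_subset hu (Set.sep_subset _ _)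
  refine le_trans (cutRank_insert_of_two_types (hτ u (hZ hu)) (hσ u (hZ hu)) (hne u (hZ hu))
    (v := u) (by simp) ?_ ?_) (h'.cutRank_le_of_lower hσ hZ hsub ?_)
  · exact h.last _ (hsub.trans hZ) u (Set.mem_insert _ _) fun z hz => hmax z (hsub hz)
  · refine h'.last _ (hsub.trans hZ) u (Set.mem_insert _ _) ?_
    rintro z (rfl | hz)
    exacts [le_rfl, hz.2.le]
  · intro z hz y hy hzy
    have hyu : qos y ≤ qos u := by
      rcases hy with rfl | hy
      exacts [le_rfl, hy.2.le]
    rcases (hzy.trans hyu).lt_or_eq with h1 | h1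
    · exact Or.inr ⟨hz, h1⟩
    · exact Or.inl (h'.injOn (hZ hz) (hZ hu) h1)

/-- If `F` carries two typed orders whose types differ everywhere, then its subsets have cut-rank
more than the logarithm of their size. -/
theorem lt_cutRank_of_two_pow_le (h : IsTypedOrder G F τ pos) (h' : IsTypedOrder G F σ qos)
    (hτ : ∀ v ∈ F, τ v ≠ 0) (hσ : ∀ v ∈ F, σ v ≠ 0) (hne : ∀ v ∈ F, τ v ≠ σ v) (t : ℕ)
    {Z : Set V} (hZ : Z ⊆ F) (ht : 2 ^ t ≤ Z.ncard) : t < cutRank G Z := by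
  have hnonempty : Z.Nonempty := by
    rw [← Set.ncard_pos]
    exact lt_of_lt_of_le (by positivity) ht
  obtain ⟨u, hu, hmax⟩ := Set.exists_max_image Z pos (Set.toFinite Z) hnonempty
  have hleft := cutRank_lower_succ_le h h' hτ hσ hne hZ hu hmax
  have hright := cutRank_lower_succ_le h h'.dual hτ hσ hne hZ hu hmax
  induction t generalizing Z u with
  | zero => omega
  | succ t ih =>
    have hcover : Z ⊆ insert u ({z ∈ Z | qos z < qos u} ∪
        {z ∈ Z | (OrderDual.toDual ∘ qos) z < (OrderDual.toDual ∘ qos) u}) := by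
      intro z hz
      rcases lt_trichotomy (qos z) (qos u) with h1 | h1 | h1
      · exact Or.inr (Or.inl ⟨hz, h1⟩)
      · exact Or.inl (h'.injOn (hZ hz) (hZ hu) h1)
      · exact Or.inr (Or.inr ⟨hz, h1⟩)
    have h1 := (Set.ncard_le_ncard hcover).trans (Set.ncard_insert_le _ _)
    have h2 := h1.trans (Nat.add_le_add_right (Set.ncard_union_le _ _) 1)
    have hstep : ∀ Y ⊆ Z, 2 ^ t ≤ Y.ncard → t < cutRank G Y := by
      intro Y hY hYt
      have hYne : Y.Nonempty := by
        rw [← Set.ncard_pos]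
        exact lt_of_lt_of_le (by positivity) hYt
      obtain ⟨v, hv, hvmax⟩ := Set.exists_max_image Y pos (Set.toFinite Y) hYne
      exact ih (hY.trans hZ) hYt hYne v hv hvmax
        (cutRank_lower_succ_le h h' hτ hσ hne (hY.trans hZ) hv hvmax)
        (cutRank_lower_succ_le h h'.dual hτ hσ hne (hY.trans hZ) hv hvmax)
    have hL := hstep _ (Set.sep_subset Z fun z => qos z < qos u)
    have hR := hstep _ (Set.sep_subset Z fun z =>
      (OrderDual.toDual ∘ qos) z < (OrderDual.toDual ∘ qos) u)
    rw [pow_succ] at ht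
    -- The parts below and above u together have at least 2^(t+1) − 1 elements, so one of them has
    -- at least 2^t.
    by_cases h3 : 2 ^ t ≤ {z ∈ Z | qos z < qos u}.ncard
    · have := hL h3
      omega
    · have := hR (by omega)
      omega

end IsTypedOrder

end Peeling

/-! ### The symplectic form restricted to a vertex set -/

section PartialForm

open Classical Module

/-- The form is nondegenerate on a space of dimension 2|P|, so a self-orthogonal subspace has at
most half that dimension. -/
theorem finrank_le_of_isotropic {P : Type*} [Fintype P]
    (W : Submodule (ZMod 2) ((P → ZMod 2) × (P → ZMod 2)))
    (h : ∀ x ∈ W, ∀ y ∈ W, ∑ i, (x.1 i * y.2 i + x.2 i * y.1 i) = 0) :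
    finrank (ZMod 2) W ≤ Fintype.card P := by
  let B : LinearMap.BilinForm (ZMod 2) ((P → ZMod 2) × (P → ZMod 2)) :=
    LinearMap.mk₂ (ZMod 2) (fun x y => ∑ i, (x.1 i * y.2 i + x.2 i * y.1 i))
      (fun x x' y => by
        rw [← Finset.sum_add_distrib]
        exact Finset.sum_congr rfl fun i _ => by
          simp only [Prod.fst_add, Prod.snd_add, Pi.add_apply]; ring)
      (fun c x y => by
        rw [smul_eq_mul, Finset.mul_sum]
        exact Finset.sum_congr rfl fun i _ => by
          simp only [Prod.smul_fst, Prod.smul_snd, Pi.smul_apply, smul_eq_mul]; ring)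
      (fun x y y' => by
        rw [← Finset.sum_add_distrib]
        exact Finset.sum_congr rfl fun i _ => by
          simp only [Prod.fst_add, Prod.snd_add, Pi.add_apply]; ring)
      (fun c x y => by
        rw [smul_eq_mul, Finset.mul_sum]
        exact Finset.sum_congr rfl fun i _ => by
          simp only [Prod.smul_fst, Prod.smul_snd, Pi.smul_apply, smul_eq_mul]; ring)
  have hB : ∀ x y, B x y = ∑ i, (x.1 i * y.2 i + x.2 i * y.1 i) := fun x y => rfl
  have hsymm : ∀ x y, B x y = B y x := by
    intro x y
    rw [hB, hB]
    exact Finset.sum_congr rfl fun i _ => by ring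
  have hsep : B.SeparatingLeft := by
    intro x hx
    refine Prod.ext (funext fun i => ?_) (funext fun i => ?_)
    · have := hx (0, Pi.single i 1)
      rw [hB] at this
      simpa [Pi.single_apply] using this
    · have := hx (Pi.single i 1, 0)
      rw [hB] at this
      simpa [Pi.single_apply] using this
  have hnd : B.Nondegenerate := ⟨hsep, fun y hy => hsep y fun x => by rw [hsymm, hy]⟩
  have h1 := LinearMap.BilinForm.finrank_orthogonal hnd W
  have h2 : W ≤ B.orthogonal W := fun x hx y hy => h y hy x hx
  have h3 := Submodule.finrank_mono h2
  have h4 : finrank (ZMod 2) ((P → ZMod 2) × (P → ZMod 2)) =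
      Fintype.card P + Fintype.card P := by
    rw [finrank_prod, finrank_fintype_fun_eq_card]
  omega

variable {V : Type*} [Fintype V]

/-- The contribution of `S` to the symplectic form on the isotropic system of `G`. -/
noncomputable def partialForm (G : SimpleGraph V) (S : Set V) :
    (V → ZMod 2) →ₗ[ZMod 2] (V → ZMod 2) →ₗ[ZMod 2] ZMod 2 :=
  LinearMap.mk₂ (ZMod 2)
    (fun p q => ∑ v with v ∈ S, (p v * neighborSum G q v + neighborSum G p v * q v))
    (fun p p' q => by
      rw [← Finset.sum_add_distrib]
      exact Finset.sum_congr rfl fun i _ => by simp only [map_add, Pi.add_apply]; ring)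
    (fun c p q => by
      rw [smul_eq_mul, Finset.mul_sum]
      exact Finset.sum_congr rfl fun i _ => by
        simp only [map_smul, Pi.smul_apply, smul_eq_mul]; ring)
    (fun p q q' => by
      rw [← Finset.sum_add_distrib]
      exact Finset.sum_congr rfl fun i _ => by simp only [map_add, Pi.add_apply]; ring)
    (fun c p q => by
      rw [smul_eq_mul, Finset.mul_sum]
      exact Finset.sum_congr rfl fun i _ => by
        simp only [map_smul, Pi.smul_apply, smul_eq_mul]; ring)

theorem partialForm_apply (G : SimpleGraph V) (S : Set V) (p q : V → ZMod 2) :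
    partialForm G S p q =
      ∑ v with v ∈ S, (p v * neighborSum G q v + neighborSum G p v * q v) := rfl

theorem partialForm_comm (G : SimpleGraph V) (S : Set V) (p q : V → ZMod 2) :
    partialForm G S p q = partialForm G S q p := by
  rw [partialForm_apply, partialForm_apply]
  exact Finset.sum_congr rfl fun i _ => by ring

theorem partialForm_self (G : SimpleGraph V) (S : Set V) (p : V → ZMod 2) :
    partialForm G S p p = 0 := by
  rw [partialForm_apply]
  refine Finset.sum_eq_zero fun i _ => ?_
  rw [mul_comm, zmod_two_add_self]

theorem partialForm_eq_zero_of_disjoint (G : SimpleGraph V) (S : Set V) {X Y : Set V}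
    (h : Disjoint X Y) {p q : V → ZMod 2} (hp : p ∈ supportedSpace G X)
    (hq : q ∈ supportedSpace G Y) : partialForm G S p q = 0 := by
  rw [partialForm_apply]
  refine Finset.sum_eq_zero fun v _ => ?_
  by_cases hv : v ∈ X
  · have := hq v fun hy => Set.disjoint_left.1 h hv hy
    simp [this.1, this.2]
  · have := hp v hv
    simp [this.1, this.2]

theorem partialForm_eq_zero_of_mem_compl (G : SimpleGraph V) (S : Set V) {p : V → ZMod 2}
    (hp : p ∈ supportedSpace G Sᶜ) (q : V → ZMod 2) : partialForm G S p q = 0 := by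
  rw [partialForm_apply]
  refine Finset.sum_eq_zero fun v hv => ?_
  have := hp v fun h => h (Finset.mem_filter.1 hv).2
  simp [this.1, this.2]

theorem partialForm_eq_partialForm_compl (G : SimpleGraph V) (S : Set V) (p q : V → ZMod 2) :
    partialForm G S p q = partialForm G Sᶜ p q := by
  have h := sum_symplectic G p q
  rw [← Finset.sum_filter_add_sum_filter_not Finset.univ (· ∈ S)] at h
  rw [partialForm_apply, partialForm_apply, CharTwo.add_eq_zero.1 h]
  exact Finset.sum_congr (by ext; simp) fun _ _ => rfl

theorem partialForm_eq_zero_of_mem (G : SimpleGraph V) (S : Set V) {p : V → ZMod 2}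
    (hp : p ∈ supportedSpace G S) (q : V → ZMod 2) : partialForm G S p q = 0 := by
  rw [partialForm_eq_partialForm_compl]
  exact partialForm_eq_zero_of_mem_compl G Sᶜ (by rwa [compl_compl]) q

theorem supportedSpace_empty (G : SimpleGraph V) : supportedSpace G ∅ = ⊥ := by
  refine eq_bot_iff.2 fun p hp => ?_
  rw [Submodule.mem_bot]
  funext v
  exact (hp v (Set.notMem_empty v)).1

/-- Pairwise orthogonal hyperbolic planes with respect to the form of `S` are bounded in number by
the cut-rank of `S`. -/
theorem card_le_cutRank_of_hyperbolic (G : SimpleGraph V) (S : Set V) {ι : Type*} [Fintype ι]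
    (p q : ι → V → ZMod 2) (hpq : ∀ i, partialForm G S (p i) (q i) = 1)
    (hpq' : ∀ i j, i ≠ j → partialForm G S (p i) (q j) = 0)
    (hpp : ∀ i j, i ≠ j → partialForm G S (p i) (p j) = 0)
    (hqq : ∀ i j, i ≠ j → partialForm G S (q i) (q j) = 0) :
    Fintype.card ι ≤ cutRank G S := by
  let Φ : (V → ZMod 2) →ₗ[ZMod 2] (ι → ZMod 2) × (ι → ZMod 2) :=
    (LinearMap.pi fun i => (partialForm G S).flip (p i)).prod
      (LinearMap.pi fun i => (partialForm G S).flip (q i))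
  have hΦ : ∀ x, Φ x = (fun i => partialForm G S x (p i), fun i => partialForm G S x (q i)) :=
    fun x => rfl
  have hsurj : Function.Surjective Φ := by
    rintro ⟨a, b⟩
    refine ⟨∑ i, (b i • p i + a i • q i), ?_⟩
    rw [hΦ]
    refine Prod.ext (funext fun j => ?_) (funext fun j => ?_)
    · simp only [map_sum, LinearMap.sum_apply, map_add, map_smul, LinearMap.add_apply,
        LinearMap.smul_apply, smul_eq_mul]
      rw [Finset.sum_eq_single j]
      · rw [partialForm_self, partialForm_comm, hpq, mul_zero, mul_one, zero_add]
      · intro i _ hij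
        rw [hpp i j hij, partialForm_comm, hpq' j i hij.symm, mul_zero, mul_zero, add_zero]
      · simp
    · simp only [map_sum, LinearMap.sum_apply, map_add, map_smul, LinearMap.add_apply,
        LinearMap.smul_apply, smul_eq_mul]
      rw [Finset.sum_eq_single j]
      · rw [partialForm_self, hpq, mul_zero, mul_one, add_zero]
      · intro i _ hij
        rw [hqq i j hij, hpq' i j hij, mul_zero, mul_zero, add_zero]
      · simp
  -- The two spaces lie in the radical and meet trivially; their sum has codimension 2ρ(S), against
  -- the 2|ι| dimensions of the target.
  have hker : supportedSpace G S ⊔ supportedSpace G Sᶜ ≤ LinearMap.ker Φ := by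
    refine sup_le (fun x hx => ?_) fun x hx => ?_
    · rw [LinearMap.mem_ker, hΦ]
      simp only [partialForm_eq_zero_of_mem G S hx]
      rfl
    · rw [LinearMap.mem_ker, hΦ]
      simp only [partialForm_eq_zero_of_mem_compl G S hx]
      rfl
  have h1 := LinearMap.finrank_range_add_finrank_ker Φ
  rw [LinearMap.range_eq_top.2 hsurj, finrank_top, finrank_prod, finrank_fintype_fun_eq_card,
    finrank_fintype_fun_eq_card] at h1
  have h2 := Submodule.finrank_mono hker
  have h3 := Submodule.finrank_sup_add_finrank_inf_eq (supportedSpace G S) (supportedSpace G Sᶜ)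
  rw [← supportedSpace_inter, Set.inter_compl_self, supportedSpace_empty, finrank_bot] at h3
  have h4 := finrank_supportedSpace_add_cutRank G S
  have h5 := finrank_supportedSpace_add_cutRank G Sᶜ
  rw [cutRank_compl] at h5
  have h6 := Set.ncard_add_ncard_compl S
  rw [Nat.card_eq_fintype_card] at h6
  omega

/-- The form of S agrees on L with that of Sᶜ. Restricted to Y \ S, the vectors on Y thus form an
isotropic space of dimension at most |Y \ S|, and the kernel of the restriction is supported on Y ∩
S. -/
theorem cutRank_inter_le_of_isotropic (G : SimpleGraph V) (S Y : Set V)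
    (h : ∀ p ∈ supportedSpace G Y, ∀ q ∈ supportedSpace G Y, partialForm G S p q = 0) :
    cutRank G (Y ∩ S) ≤ cutRank G Y := by
  let r : (V → ZMod 2) →ₗ[ZMod 2] (↥(Y \ S) → ZMod 2) × (↥(Y \ S) → ZMod 2) :=
    (LinearMap.funLeft (ZMod 2) (ZMod 2) Subtype.val).prod
      (LinearMap.funLeft (ZMod 2) (ZMod 2) Subtype.val ∘ₗ neighborSum G)
  have hr : ∀ p, r p = (fun i : ↥(Y \ S) => p i, fun i : ↥(Y \ S) => neighborSum G p i) :=
    fun p => rfl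
  have h1 : finrank (ZMod 2) ((supportedSpace G Y).map r) ≤ Fintype.card ↥(Y \ S) := by
    refine finrank_le_of_isotropic _ ?_
    rintro _ ⟨p, hp, rfl⟩ _ ⟨q, hq, rfl⟩
    have h2 := h p hp q hq
    rw [partialForm_eq_partialForm_compl, partialForm_apply] at h2
    rw [hr, hr]
    refine Eq.trans ?_ h2
    rw [← Finset.sum_subset (s₁ := Finset.univ.filter (· ∈ Y \ S))]
    · exact (Finset.sum_subtype _ (fun x => by simp)
        (fun v => p v * neighborSum G q v + neighborSum G p v * q v)).symm
    · intro v hv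
      simp only [Finset.mem_filter, Finset.mem_univ, true_and] at hv ⊢
      exact hv.2
    · intro v hv hv'
      simp only [Finset.mem_filter, Finset.mem_univ, true_and] at hv hv'
      have := hp v fun hY => hv' ⟨hY, hv⟩
      simp [this.1, this.2]
  have h2 := LinearMap.finrank_range_add_finrank_ker (r.domRestrict (supportedSpace G Y))
  rw [LinearMap.range_domRestrict] at h2
  have h3 : (LinearMap.ker (r.domRestrict (supportedSpace G Y))).map
      (supportedSpace G Y).subtype ≤ supportedSpace G (Y ∩ S) := by
    rintro _ ⟨p, hp, rfl⟩ v hv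
    have hp' : r p.1 = 0 := hp
    rw [hr] at hp'
    by_cases hvY : v ∈ Y
    · have hvS : v ∈ Y \ S := ⟨hvY, fun h => hv ⟨hvY, h⟩⟩
      exact ⟨congrFun (congrArg Prod.fst hp') ⟨v, hvS⟩, congrFun (congrArg Prod.snd hp') ⟨v, hvS⟩⟩
    · exact p.2 v hvY
  have h4 := Submodule.finrank_mono h3
  rw [Submodule.finrank_map_subtype_eq] at h4
  have h5 := finrank_supportedSpace_add_cutRank G Y
  have h6 := finrank_supportedSpace_add_cutRank G (Y ∩ S)
  have h7 := Set.ncard_inter_add_ncard_sdiff_eq_ncard Y S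
  rw [← Nat.card_eq_fintype_card, Nat.card_coe_set_eq] at h1
  omega

end PartialForm

/-! ### Playing the two chains against each other -/

section Intertwining

variable {V : Type*} [Fintype V] {G : SimpleGraph V} {Q R S T : Set V}

/-- The set between two tight sets has cut-rank at most twice the connectivity. -/
theorem IsTight.cutRank_sdiff_le {X Y : Set V} (hX : IsTight G Q R X) (hY : IsTight G Q R Y) :
    cutRank G (Y \ X) ≤ 2 * connectivity G Q R := by
  have h := cutRank_submodular G Y Xᶜ
  rw [cutRank_compl, hX.cutRank_eq, hY.cutRank_eq] at h
  rw [Set.sdiff_eq_compl_inter, Set.inter_comm]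
  omega

theorem ncard_lt_of_isReducing {F : Set V} (hQR : Q ∩ R = ∅) (hST : S ∩ T = ∅)
    (hF : F = (Q ∪ R ∪ S ∪ T)ᶜ) {τ σ : V → ZMod 2 × ZMod 2}
    (hτ : ∀ v ∈ F, τ v ≠ 0) (hσ : ∀ v ∈ F, σ v ≠ 0) (hne : ∀ v ∈ F, τ v ≠ σ v)
    (h1 : ∀ v ∈ F, IsReducing G Q R v (τ v)) (h2 : ∀ v ∈ F, IsReducing G S T v (σ v)) :
    F.ncard < (2 * connectivity G S T + 1) * 2 ^ (2 * connectivity G Q R) := by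
  by_contra! hcard
  set k := connectivity G Q R with hk
  set l := connectivity G S T with hl
  obtain ⟨D, pos, hmono, hD, hDcard, hpos⟩ := exists_chain_and_isTypedOrder hQR h1
  obtain ⟨C, qos, -, hC, hCcard, hqos⟩ := exists_chain_and_isTypedOrder hST h2
  set U : Set V := C F.ncard \ C 0 with hU
  have hUl : cutRank G U ≤ 2 * l := (hC 0).cutRank_sdiff_le (hC _)
  have hFU : F ⊆ U := by
    have hl1 : F ∩ C F.ncard = F :=
      Set.eq_of_subset_of_ncard_le Set.inter_subset_left (hCcard _ le_rfl).ge
    have hl2 : F ∩ C 0 = ∅ := (Set.ncard_eq_zero (Set.toFinite _)).1 (hCcard 0 (Nat.zero_le _))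
    intro v hv
    refine ⟨(hl1.ge hv).2, fun h => ?_⟩
    have : v ∈ F ∩ C 0 := ⟨hv, h⟩
    rw [hl2] at this
    exact this
  set N := 2 ^ (2 * k) with hN
  let Y : Fin (2 * l + 1) → Set V := fun t => D ((t + 1) * N) \ D (t * N)
  -- A slice of the first chain avoids Q ∪ R and U avoids S ∪ T, so their intersection lies in F.
  have hYF : ∀ t, Y t ∩ U = F ∩ Y t := by
    intro t
    refine subset_antisymm (fun v hv => ⟨?_, hv.1⟩) fun v hv => ⟨hv.2, hFU hv.1⟩
    rw [hF]
    rintro (((h | h) | h) | h)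
    · exact hv.1.2 ((hD _).left h)
    · exact (hD _).right hv.1.1 h
    · exact hv.2.2 ((hC _).left h)
    · exact (hC _).right hv.2.1 h
  have hYcard : ∀ t, (F ∩ Y t).ncard = N := by
    intro t
    have ht : ((t : ℕ) + 1) * N ≤ F.ncard :=
      (Nat.mul_le_mul_right N (by omega)).trans hcard
    have ht' : (t : ℕ) * N ≤ ((t : ℕ) + 1) * N := Nat.mul_le_mul_right N (by omega)
    have h3 : F ∩ Y t = (F ∩ D ((t + 1) * N)) \ (F ∩ D (t * N)) := by
      ext v
      simp only [Y, Set.mem_inter_iff, Set.mem_sdiff]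
      tauto
    rw [h3, Set.ncard_sdiff (Set.inter_subset_inter_right F (hmono ht')), hDcard _ ht,
      hDcard _ (ht'.trans ht), add_mul, one_mul, Nat.add_sub_cancel_left]
  have hYdisj : ∀ i j, i ≠ j → Disjoint (Y i) (Y j) := by
    have hlt : ∀ i j : Fin (2 * l + 1), i < j → Disjoint (Y i) (Y j) := by
      intro i j hij
      refine Set.disjoint_left.2 fun v hi hj => hj.2 (hmono ?_ hi.1)
      exact Nat.mul_le_mul_right N hij
    intro i j hij
    rcases lt_or_gt_of_ne hij with h | h
    exacts [hlt i j h, (hlt j i h).symm]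
  -- Otherwise the disjoint slices supply 2ℓ+1 orthogonal hyperbolic pairs, more than the cut-rank
  -- 2ℓ allowed for U.
  obtain ⟨t, ht⟩ : ∃ t, ∀ p ∈ supportedSpace G (Y t), ∀ q ∈ supportedSpace G (Y t),
      partialForm G U p q = 0 := by
    by_contra! hcon
    choose p hp q hq hpq using hcon
    have hz : ∀ a : ZMod 2, a ≠ 0 → a = 1 := by decide
    have := card_le_cutRank_of_hyperbolic G U p q (fun i => hz _ (hpq i))
      (fun i j hij => partialForm_eq_zero_of_disjoint G U (hYdisj i j hij) (hp i) (hq j))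
      (fun i j hij => partialForm_eq_zero_of_disjoint G U (hYdisj i j hij) (hp i) (hp j))
      (fun i j hij => partialForm_eq_zero_of_disjoint G U (hYdisj i j hij) (hq i) (hq j))
    rw [Fintype.card_fin] at this
    omega
  have h3 := cutRank_inter_le_of_isotropic G U (Y t) ht
  rw [hYF] at h3
  have h4 : cutRank G (Y t) ≤ 2 * k := (hD _).cutRank_sdiff_le (hD _)
  have h5 := hpos.lt_cutRank_of_two_pow_le hqos hτ hσ hne (2 * k) (Z := F ∩ Y t)
    Set.inter_subset_left (hYcard t).ge
  omega

/-- Some vector is nonzero at v and killed by both types; distinct nonzero types have no common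
nonzero zero. -/
theorem IsReducing.type_unique {v : V} {τ σ : ZMod 2 × ZMod 2} (hτ : τ ≠ 0) (hσ : σ ≠ 0)
    (h : IsReducing G Q R v τ) (h' : IsReducing G Q R v σ) : τ = σ := by
  by_contra hne
  obtain ⟨X, hvX, hX, hX', hX''⟩ := h
  obtain ⟨w, hw, hw0, hw1⟩ := h'.exists_mem_of_isTight hX hX'
  have hw2 := hX'' w hw
  rw [typeFunctional_apply] at hw1 hw2
  exact hw0 (types_separate τ σ hτ hσ hne _ _ hw2 hw1)

/-- If two ways of removing `v` fail to preserve the two connectivities, then one of them reduces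
the first connectivity and the other one reduces the second. -/
theorem exists_types_of_not {H H' : SimpleGraph V} {v : V} {τ σ : ZMod 2 × ZMod 2}
    (hQR : Q ∩ R = ∅) (hST : S ∩ T = ∅) (hv : v ∉ Q ∪ R ∪ S ∪ T)
    (hτ : τ ≠ 0) (hσ : σ ≠ 0) (hne : τ ≠ σ)
    (hH : IsTransferOfType G H v τ) (hH' : IsTransferOfType G H' v σ)
    (h : ¬ DeletionHasConnectivities H v Q R S T (connectivity G Q R) (connectivity G S T))
    (h' : ¬ DeletionHasConnectivities H' v Q R S T (connectivity G Q R) (connectivity G S T)) :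
    ∃ a b : ZMod 2 × ZMod 2, a ≠ 0 ∧ b ≠ 0 ∧ a ≠ b ∧
      IsReducing G Q R v a ∧ IsReducing G S T v b := by
  simp only [Set.mem_union, not_or] at hv
  obtain ⟨⟨⟨hvQ, hvR⟩, hvS⟩, hvT⟩ := hv
  have key : ∀ (K : SimpleGraph V) (ρ : ZMod 2 × ZMod 2), ρ ≠ 0 → IsTransferOfType G K v ρ →
      ¬ DeletionHasConnectivities K v Q R S T (connectivity G Q R) (connectivity G S T) →
      IsReducing G Q R v ρ ∨ IsReducing G S T v ρ := by
    intro K ρ hρ hK hn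
    rcases not_and_or.1 hn with h1 | h1
    · exact Or.inl (IsReducing.of_connectivity_ne hρ hQR hvQ hvR hK h1)
    · exact Or.inr (IsReducing.of_connectivity_ne hρ hST hvS hvT hK h1)
  rcases key H τ hτ hH h with h1 | h1 <;> rcases key H' σ hσ hH' h' with h2 | h2
  · exact absurd (h1.type_unique hτ hσ h2) hne
  · exact ⟨τ, σ, hτ, hσ, hne, h1, h2⟩
  · exact ⟨σ, τ, hσ, hτ, hne.symm, h2, h1⟩
  · exact absurd (h1.type_unique hτ hσ h2) hne

end Intertwining

end VertexMinor

/-! ### The main theorem -/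

theorem theorem1p2 {V : Type*} [Finite V] (G : SimpleGraph V) (Q R S T F : Set V)
    (hQR : Q ∩ R = ∅) (hST : S ∩ T = ∅) (k l : ℕ)
    (hk : VertexMinor.connectivity G Q R = k) (hl : VertexMinor.connectivity G S T = l)
    (hF : F = (Q ∪ R ∪ S ∪ T)ᶜ) (hcard : (2 * l + 1) * 2 ^ (2 * k) ≤ F.ncard) :
    ∃ v ∈ F, VertexMinor.AtLeastTwo
      (VertexMinor.DeletionHasConnectivities G v Q R S T k l)
      (VertexMinor.DeletionHasConnectivities (VertexMinor.localComplement G v) v Q R S T k l)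
      (∀ u : V, G.Adj u v →
        VertexMinor.DeletionHasConnectivities (VertexMinor.pivot G u v) v Q R S T k l) := by
  open VertexMinor in
  have := Fintype.ofFinite V
  subst hk hl
  by_contra! hcon
  have hex : ∀ v ∈ F, ∃ a b : ZMod 2 × ZMod 2, a ≠ 0 ∧ b ≠ 0 ∧ a ≠ b ∧
      IsReducing G Q R v a ∧ IsReducing G S T v b := by
    intro v hv
    have hv' : v ∉ Q ∪ R ∪ S ∪ T := by rwa [hF] at hv
    have hnot := hcon v hv
    by_cases h1 : DeletionHasConnectivities G v Q R S T (connectivity G Q R) (connectivity G S T)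
    · have h2 : ¬ DeletionHasConnectivities (localComplement G v) v Q R S T
          (connectivity G Q R) (connectivity G S T) := fun h => hnot (Or.inl ⟨h1, h⟩)
      have h3 : ¬ ∀ u : V, G.Adj u v → DeletionHasConnectivities (pivot G u v) v Q R S T
          (connectivity G Q R) (connectivity G S T) := fun h => hnot (Or.inr (Or.inl ⟨h1, h⟩))
      push Not at h3
      obtain ⟨u, hu, h3⟩ := h3
      exact exists_types_of_not hQR hST hv' (by decide) (by decide) (by decide)
        (isTransferOfType_localComplement G v) (isTransferOfType_pivot hu) h2 h3
    · by_cases h2 : DeletionHasConnectivities (localComplement G v) v Q R S T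
          (connectivity G Q R) (connectivity G S T)
      · have h3 : ¬ ∀ u : V, G.Adj u v → DeletionHasConnectivities (pivot G u v) v Q R S T
            (connectivity G Q R) (connectivity G S T) := fun h => hnot (Or.inr (Or.inr ⟨h2, h⟩))
        push Not at h3
        obtain ⟨u, hu, h3⟩ := h3
        exact exists_types_of_not hQR hST hv' (by decide) (by decide) (by decide)
          (isTransferOfType_refl G v) (isTransferOfType_pivot hu) h1 h3
      · exact exists_types_of_not hQR hST hv' (by decide) (by decide) (by decide)
          (isTransferOfType_refl G v) (isTransferOfType_localComplement G v) h1 h2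
  have hex' : ∀ v, ∃ a b : ZMod 2 × ZMod 2, v ∈ F → a ≠ 0 ∧ b ≠ 0 ∧ a ≠ b ∧
      IsReducing G Q R v a ∧ IsReducing G S T v b := by
    intro v
    by_cases hv : v ∈ F
    · obtain ⟨a, b, h⟩ := hex v hv
      exact ⟨a, b, fun _ => h⟩
    · exact ⟨0, 0, fun h => absurd h hv⟩
  choose τ σ h using hex'
  exact absurd (ncard_lt_of_isReducing hQR hST hF (fun v hv => (h v hv).1)
    (fun v hv => (h v hv).2.1) (fun v hv => (h v hv).2.2.1) (fun v hv => (h v hv).2.2.2.1)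
    (fun v hv => (h v hv).2.2.2.2)) (not_lt.2 hcard)
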